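/- A *game* $G=\{\mathcal G^L\mid\mathcal G^R\}$ is given recursively by a set of Left options and a set of Right options (with no infinite runs of play), and $G+H$ denotes the disjunctive sum, in which the player to move moves in exactly one of the two components. Under misère play the player who makes the last move loses; $o^-(G)\in\{\mathcal L,\mathcal N,\mathcal P,\mathcal R\}$ denotes the outcome class of $G$ under misère play. For an impartial game $G$ with finitely many positions, the normal-play nim-value $g^+(G)$ is the least non-negative integer that is not the normal-play nim-value of an option of $G$. The nim-heap $*_n$ is the game in which both players have the options $*_0,\dots,*_{n-1}$. A *Green Hackenbush* position is a finite graph (loops and multiple edges allowed) with a designated set of ground vertices; a move of either player is to cut one edge, and every component that is not connected to the ground is discarded. A (green) *Shrub* is such a position with exactly one ground vertex, the root, and with root of degree $1$. The *Stalk* of height $n$ is the path with $n$ edges, one end of which is its only ground vertex. **Theorem.** Let $S$ be a Shrub and let $n=g^+(S)$ be its normal-play nim-value. Then $S$ is equivalent in the whole misère universe to the nim-heap $*_n$ and to the Stalk of height $n$: for every (possibly partizan) game $T$, $$o^-(S+T)=o^-(*_n+T)\qquad\text{and}\qquad o^-(S+T)=o^-(\mathrm{Stalk}_n+T).$$ 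-/

import Mathlib

universe u v

/-! ### Combinatorial games -/

/-- The two players. -/
inductive Player where
  | left
  | right

/-- The opponent of a player. -/
def Player.other : Player → Player
  | .left => .right
  | .right => .left

/-- The two play conventions: the last player to move wins under normal play and loses under
misère play. -/
inductive Convention where
  | normal
  | misere

/-- The four outcome classes: Left-player win, Next-player win, Previous-player win and
Right-player win. -/
inductive Outcome where
  | L
  | N
  | P
  | R

/-- A (partizan, well-founded) combinatorial game `{Gᴸ | Gᴿ}`: for each player `p` a family of
options, indexed by `index p`, each of which is again a game. -/
inductive CombGame : Type (u + 1) where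
  | mk (index : Player → Type u) (option : (p : Player) → index p → CombGame) : CombGame

namespace CombGame

/-- `G.WinsFirst c p`: under the convention `c`, the player `p` wins `G` when `p` is to move.
Either `p` cannot move, which is a win exactly under misère play, or `p` has a move to an option
that the opponent, who moves next, does not win. -/
def WinsFirst (c : Convention) : CombGame.{u} → Player → Prop
  | mk I f, p => (c = .misere ∧ IsEmpty (I p)) ∨ ∃ i : I p, ¬ WinsFirst c (f p i) p.other

open Classical in
/-- The outcome class of a game under a play convention. -/
noncomputable def outcome (c : Convention) (G : CombGame.{u}) : Outcome :=
  if G.WinsFirst c .left then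
    if G.WinsFirst c .right then .N else .L
  else
    if G.WinsFirst c .right then .R else .P

/-- Auxiliary step for the disjunctive sum: given the functions `H ↦ G' + H` for all the options
`G'` of a game `G` (indexed by `I`), the function `H ↦ G + H`. -/
def addStep (I : Player → Type u) (F : (p : Player) → I p → CombGame.{u} → CombGame.{u}) :
    CombGame.{u} → CombGame.{u}
  | mk J g => mk (fun p => I p ⊕ J p) (fun p =>
      Sum.elim (fun i => F p i (mk J g)) (fun j => addStep I F (g p j)))

/-- The disjunctive sum: the player to move moves in exactly one of the two components. -/
def add : CombGame.{u} → CombGame.{u} → CombGame.{u}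
  | mk I f => addStep I (fun p i => add (f p i))

instance : Add CombGame.{u} := ⟨add⟩

/-- The recursive definition of the disjunctive sum,
`G + H = {Gᴸ + H, G + Hᴸ | Gᴿ + H, G + Hᴿ}`. -/
theorem mk_add_mk (I J : Player → Type u) (f : (p : Player) → I p → CombGame.{u})
    (g : (p : Player) → J p → CombGame.{u}) :
    mk I f + mk J g = mk (fun p => I p ⊕ J p) (fun p =>
      Sum.elim (fun i => f p i + mk J g) (fun j => mk I f + g p j)) :=
  rfl

/-- The normal-play nim-value (Grundy value) `g⁺` of an impartial game with finitely many
options: the least natural number which is not the nim-value of an option. In an impartial game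
the options of the two players coincide, so that it does not matter which player moves. -/
noncomputable def nimValue : CombGame.{u} → ℕ
  | mk I f => sInf {m : ℕ | ∀ (p : Player) (i : I p), nimValue (f p i) ≠ m}

/-- The nim-heap `*ₙ = {*₀, …, *ₙ₋₁ | *₀, …, *ₙ₋₁}`. -/
def nimHeap (n : ℕ) : CombGame.{u} :=
  mk (fun _ => ULift.{u} (Fin n)) (fun _ i => nimHeap i.down.val)
termination_by n
decreasing_by exact i.down.isLt

end CombGame

/-! ### Hackenbush -/

/-- The colours of the edges. -/
inductive EdgeColor where
  | red
  | blue
  | green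

/-- Left may cut the blue and the green edges, Right the red and the green ones. -/
def EdgeColor.CutBy : EdgeColor → Player → Prop
  | .green, _ => True
  | .blue, p => p = .left
  | .red, p => p = .right

/-- A Hackenbush position: a finite graph (loops and multiple edges are allowed) with coloured
edges, and a set of vertices designated as the ground. -/
structure HackenbushPosition (V : Type v) (E : Type u) where
  graph : Graph V E
  finite_vertexSet : graph.vertexSet.Finite
  finite_edgeSet : graph.edgeSet.Finite
  ground : Set V
  ground_subset : ground ⊆ graph.vertexSet
  color : E → EdgeColor

namespace HackenbushPosition

variable {V : Type v} {E : Type u}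

/-- The vertices that are connected to the ground. -/
def groundedSet (P : HackenbushPosition V E) : Set V :=
  {x | ∃ r ∈ P.ground, Relation.ReflTransGen P.graph.Adj r x}

theorem groundedSet_subset (P : HackenbushPosition V E) :
    P.groundedSet ⊆ P.graph.vertexSet := by
  rintro x ⟨r, hr, h⟩
  rcases Relation.ReflTransGen.cases_tail h with rfl | ⟨y, -, e, he⟩
  · exact P.ground_subset hr
  · exact he.right_mem

/-- Discard every component that is not connected to the ground. -/
def discard (P : HackenbushPosition V E) : HackenbushPosition V E where
  graph := P.graph.induce P.groundedSet
  finite_vertexSet := P.finite_vertexSet.subset P.groundedSet_subset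
  finite_edgeSet := P.finite_edgeSet.subset (by
    rintro e ⟨x, y, h, -⟩
    exact h.edge_mem)
  ground := P.ground
  ground_subset := fun r hr => ⟨r, hr, Relation.ReflTransGen.refl⟩
  color := P.color

/-- Delete the edge `e`. -/
def deleteEdge (P : HackenbushPosition V E) (e : E) : HackenbushPosition V E where
  graph := P.graph.deleteEdges {e}
  finite_vertexSet := P.finite_vertexSet
  finite_edgeSet := P.finite_edgeSet.subset Set.sdiff_subset
  ground := P.ground
  ground_subset := P.ground_subset
  color := P.color

/-- The position after cutting the edge `e`: the edge is deleted, and the components that are no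
longer connected to the ground are discarded. -/
def cut (P : HackenbushPosition V E) (e : E) : HackenbushPosition V E :=
  (P.deleteEdge e).discard

theorem ncard_edgeSet_cut_lt (P : HackenbushPosition V E) {e : E} (he : e ∈ P.graph.edgeSet) :
    (P.cut e).graph.edgeSet.ncard < P.graph.edgeSet.ncard := by
  refine Set.ncard_lt_ncard ⟨?_, fun h => ?_⟩ P.finite_edgeSet
  · rintro f ⟨x, y, h, -⟩
    exact ((Graph.deleteEdges_isLink ..).mp h).1.edge_mem
  · obtain ⟨x, y, h, -⟩ := h he
    exact ((Graph.deleteEdges_isLink ..).mp h).2 rfl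

/-- The game played on a position in which nothing has to be discarded: a move of the player `p`
is to cut an edge of a colour that `p` may cut. -/
noncomputable def play (P : HackenbushPosition V E) : CombGame.{u} :=
  CombGame.mk (fun p => {e : E // e ∈ P.graph.edgeSet ∧ (P.color e).CutBy p})
    (fun _ e => play (P.cut e.1))
termination_by P.graph.edgeSet.ncard
decreasing_by exact P.ncard_edgeSet_cut_lt e.2.1

/-- The game of a Hackenbush position. Components that are not connected to the ground are
discarded at every stage, also at the start. -/
noncomputable def toGame (P : HackenbushPosition V E) : CombGame.{u} :=
  P.discard.play

/-- The degree of a vertex in the underlying graph; a loop counts twice. -/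
noncomputable def degree (P : HackenbushPosition V E) (x : V) : ℕ∞ :=
  (P.graph.incidenceSet x).encard + (P.graph.loopSet x).encard

/-- A (green) Shrub: all edges are green, there is exactly one vertex on the ground, the root, and
the root has degree one. -/
def IsShrub (P : HackenbushPosition V E) : Prop :=
  (∀ e ∈ P.graph.edgeSet, P.color e = .green) ∧ ∃ r, P.ground = {r} ∧ P.degree r = 1

/-- The Stalk of height `n`: a green path with the vertices `0, …, n`, in which the edge `i < n`
joins `i` and `i + 1`, and where only the end `0` is on the ground. -/
def stalk (n : ℕ) : HackenbushPosition ℕ (ULift.{u} ℕ) where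
  graph :=
    { vertexSet := Set.Iic n
      IsLink := fun e x y =>
        e.down < n ∧ (x = e.down ∧ y = e.down + 1 ∨ y = e.down ∧ x = e.down + 1)
      isLink_symm := fun _ _ => ⟨fun _ _ h => ⟨h.1, h.2.symm⟩⟩
      eq_or_eq_of_isLink_of_isLink := by
        rintro e x y z w ⟨-, h⟩ ⟨-, h'⟩
        omega
      left_mem_of_isLink := by
        rintro e x y ⟨h, h'⟩
        simp only [Set.mem_Iic]
        omega }
  finite_vertexSet := Set.finite_Iic n
  finite_edgeSet := by
    refine ((Set.finite_Iio n).preimage (ULift.down_injective.injOn)).subset ?_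
    rintro e ⟨x, y, h, -⟩
    exact h
  ground := {0}
  ground_subset := by
    rintro x rfl
    exact Nat.zero_le n
  color := fun _ => .green

end HackenbushPosition

/-! The mex rule survives under misère play in a restricted form. Suppose all options of a game are
equivalent to nim-heaps of sizes other than `n`, and both players can reach every size below `n`. A
move to a heap larger than `n` can be answered by reducing that heap to `n`, so it gains nothing.
The one obstruction is `n = 0`: `*₀` has no move, and under misère play being unable to move wins,
so then the game must have no moves either (`misereEquiv_nimHeap`).

Shrubs never meet this obstruction. Cutting the root edge moves to the empty game, so the nim-value
is positive; cutting any other edge leaves a smaller Shrub, equivalent to a nim-heap by induction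
(`IsShrub.play_misereEquiv`). The same rule applied to Stalks gives `play_stalk_misereEquiv`. -/

namespace CombGame

/-! ### Misère equivalence and the mex rule -/

/-- Two games are misère equivalent when they have the same winners in every sum. -/
def MisereEquiv (G H : CombGame.{u}) : Prop :=
  ∀ (T : CombGame.{u}) (p : Player),
    (G + T).WinsFirst .misere p ↔ (H + T).WinsFirst .misere p

theorem MisereEquiv.symm {G H : CombGame.{u}} (h : MisereEquiv G H) : MisereEquiv H G :=
  fun T p => (h T p).symm

theorem MisereEquiv.trans {G H K : CombGame.{u}} (h : MisereEquiv G H) (h' : MisereEquiv H K) :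
    MisereEquiv G K :=
  fun T p => (h T p).trans (h' T p)

theorem MisereEquiv.outcome_add_eq {G H : CombGame.{u}} (h : MisereEquiv G H)
    (T : CombGame.{u}) : outcome .misere (G + T) = outcome .misere (H + T) := by
  have hl := h T .left
  have hr := h T .right
  unfold outcome
  split_ifs <;> first | rfl | (exfalso; tauto)

theorem winsFirst_misere_mk_add_mk (I J : Player → Type u)
    (f : (p : Player) → I p → CombGame.{u}) (g : (p : Player) → J p → CombGame.{u})
    (p : Player) :
    (mk I f + mk J g).WinsFirst .misere p ↔
      (IsEmpty (I p) ∧ IsEmpty (J p)) ∨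
        (∃ i, ¬ (f p i + mk J g).WinsFirst .misere p.other) ∨
          ∃ j, ¬ (mk I f + g p j).WinsFirst .misere p.other := by
  rw [mk_add_mk, WinsFirst]
  simp [isEmpty_sum]

theorem nimHeap_eq_mk (n : ℕ) :
    nimHeap.{u} n =
      mk (fun _ => ULift.{u} (Fin n)) (fun _ i => nimHeap i.down.val) := by
  rw [nimHeap]

/-- Moving in a nim-heap to a smaller one. -/
theorem winsFirst_nimHeap_add_of_lt {m n : ℕ} (h : m < n) (T : CombGame.{u}) (p : Player)
    (hm : ¬ (nimHeap m + T).WinsFirst .misere p.other) :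
    (nimHeap n + T).WinsFirst .misere p := by
  cases T with
  | mk J g =>
    rw [nimHeap_eq_mk n, winsFirst_misere_mk_add_mk]
    exact .inr (.inl ⟨⟨⟨m, h⟩⟩, hm⟩)

theorem _root_.Player.other_other (p : Player) : p.other.other = p := by
  cases p <;> rfl

/-- The misère mex rule, for games in which the moves to larger nim-heaps occur only in the
presence of a move to `0`. -/
theorem misereEquiv_nimHeap {I : Player → Type u} {f : (p : Player) → I p → CombGame.{u}} {n : ℕ}
    (h_option : ∀ p i, ∃ k, k ≠ n ∧ MisereEquiv (f p i) (nimHeap k))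
    (h_lt : ∀ p, ∀ k < n, ∃ i, MisereEquiv (f p i) (nimHeap k))
    (h_zero : n = 0 → ∀ p, IsEmpty (I p)) :
    MisereEquiv (mk I f) (nimHeap n) := by
  intro T
  induction T with
  | mk J g ih =>
    intro p
    constructor
    · rw [winsFirst_misere_mk_add_mk]
      rintro (⟨hI, hJ⟩ | ⟨i, hi⟩ | ⟨j, hj⟩)
      · rw [nimHeap_eq_mk, winsFirst_misere_mk_add_mk]
        refine .inl ⟨⟨fun k => ?_⟩, hJ⟩
        obtain ⟨i, -⟩ := h_lt p k.down.1 k.down.2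
        exact hI.elim i
      · obtain ⟨k, hkn, hk⟩ := h_option p i
        rw [hk] at hi
        rcases lt_or_gt_of_ne hkn with hlt | hgt
        · exact winsFirst_nimHeap_add_of_lt hlt _ _ hi
        -- Reversal: the opponent answers the move to `*ₖ`, `k > n`, by restoring `*ₙ`, where `p` is
        -- to move and does not win.
        · by_contra hn
          refine hi (winsFirst_nimHeap_add_of_lt hgt _ _ ?_)
          rwa [Player.other_other]
      · rw [ih] at hj
        rw [nimHeap_eq_mk, winsFirst_misere_mk_add_mk, ← nimHeap_eq_mk]
        exact .inr (.inr ⟨j, hj⟩)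
    · rw [nimHeap_eq_mk, winsFirst_misere_mk_add_mk, ← nimHeap_eq_mk, winsFirst_misere_mk_add_mk]
      rintro (⟨hI, hJ⟩ | ⟨k, hk⟩ | ⟨j, hj⟩)
      -- No move in `*ₙ` forces `n = 0`; this is the only place where `h_zero` is needed.
      · refine .inl ⟨h_zero ?_ p, hJ⟩
        by_contra hn
        exact hI.elim ⟨⟨0, Nat.pos_of_ne_zero hn⟩⟩
      · obtain ⟨i, hi⟩ := h_lt p k.down.1 k.down.2
        exact .inr (.inl ⟨i, by rwa [hi]⟩)
      · exact .inr (.inr ⟨j, by rwa [ih]⟩)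

theorem misereEquiv_nimHeap_zero {I : Player → Type u} {f : (p : Player) → I p → CombGame.{u}}
    (h : ∀ p, IsEmpty (I p)) : MisereEquiv (mk I f) (nimHeap 0) :=
  misereEquiv_nimHeap (fun p i => (h p).elim i) (fun _ _ hk => absurd hk (Nat.not_lt_zero _))
    (fun _ => h)

/-! ### Nim-values as minimal excluded values -/

theorem nimValue_eq_zero {I : Player → Type u} {f : (p : Player) → I p → CombGame.{u}}
    (h : ∀ p, IsEmpty (I p)) : nimValue (mk I f) = 0 := by
  rw [nimValue, Nat.sInf_eq_zero]
  exact .inl fun p i => (h p).elim i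

/-- Finitely many options leave some value unattained; otherwise `sInf ∅ = 0` could be the value of
an option. -/
theorem nimValue_option_ne {I : Player → Type u} [∀ p, Finite (I p)]
    (f : (p : Player) → I p → CombGame.{u}) (p : Player) (i : I p) :
    nimValue (f p i) ≠ nimValue (mk I f) := by
  have hne : {m : ℕ | ∀ (p : Player) (i : I p), nimValue (f p i) ≠ m}.Nonempty := by
    have hfin : (⋃ p ∈ ({.left, .right} : Set Player),
        Set.range fun i => nimValue (f p i)).Finite :=
      Set.Finite.biUnion (by simp) fun p _ => Set.finite_range _
    obtain ⟨m, hm⟩ := hfin.exists_notMem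
    refine ⟨m, fun p i h => hm ?_⟩
    simp only [Set.mem_iUnion]
    exact ⟨p, by cases p <;> simp, i, h⟩
  conv_rhs => rw [nimValue]
  exact Nat.sInf_mem hne p i

theorem exists_nimValue_option_eq {I : Player → Type u}
    (f : (p : Player) → I p → CombGame.{u}) {k : ℕ} (hk : k < nimValue (mk I f)) :
    ∃ p i, nimValue (f p i) = k := by
  rw [nimValue] at hk
  simpa using Nat.notMem_of_lt_sInf hk

end CombGame

namespace HackenbushPosition

open CombGame

variable {V : Type v} {E : Type u}

/-! ### Shrubs and their cuts -/

theorem edgeSet_discard_subset (P : HackenbushPosition V E) :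
    P.discard.graph.edgeSet ⊆ P.graph.edgeSet := by
  rintro e ⟨x, y, h, -⟩
  exact h.edge_mem

/-- Both ends of an edge at a ground vertex are grounded, so discarding keeps the edge. -/
theorem isLink_discard_of_mem_ground (P : HackenbushPosition V E) {r : V} (hr : r ∈ P.ground)
    {e : E} {x : V} : P.discard.graph.IsLink e r x ↔ P.graph.IsLink e r x :=
  ⟨fun h => h.1, fun h => ⟨h, ⟨r, hr, .refl⟩, ⟨r, hr, .single ⟨e, h⟩⟩⟩⟩

theorem degree_discard (P : HackenbushPosition V E) {r : V} (hr : r ∈ P.ground) :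
    P.discard.degree r = P.degree r := by
  have h := @isLink_discard_of_mem_ground _ _ P r hr
  have h₁ : P.discard.graph.incidenceSet r = P.graph.incidenceSet r :=
    Set.ext fun e => exists_congr fun x => h
  have h₂ : P.discard.graph.loopSet r = P.graph.loopSet r := Set.ext fun e => h
  rw [degree, degree, h₁, h₂]

theorem degree_deleteEdge_of_not_inc (P : HackenbushPosition V E) {r : V} {e : E}
    (he : ¬ P.graph.Inc e r) : (P.deleteEdge e).degree r = P.degree r := by
  have h (f : E) (x : V) : (P.deleteEdge e).graph.IsLink f r x ↔ P.graph.IsLink f r x := by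
    refine (Graph.deleteEdges_isLink ..).to_iff.trans ⟨fun h => h.1, fun h => ⟨h, ?_⟩⟩
    rintro rfl
    exact he ⟨x, h⟩
  have h₁ : (P.deleteEdge e).graph.incidenceSet r = P.graph.incidenceSet r :=
    Set.ext fun f => exists_congr fun x => h f x
  have h₂ : (P.deleteEdge e).graph.loopSet r = P.graph.loopSet r := Set.ext fun f => h f r
  rw [degree, degree, h₁, h₂]

/-- Every loop at `r` is also an incident edge, so a degree of 1 cannot come from the loop term
alone. -/
theorem exists_incidenceSet_eq_singleton (P : HackenbushPosition V E) {r : V}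
    (hr : P.degree r = 1) : ∃ e, P.graph.incidenceSet r = {e} := by
  rw [← Set.encard_eq_one]
  have h_le : (P.graph.loopSet r).encard ≤ (P.graph.incidenceSet r).encard :=
    Set.encard_le_encard fun e he => ⟨r, he⟩
  refine le_antisymm (hr ▸ le_self_add) ?_
  rw [Order.one_le_iff_pos, pos_iff_ne_zero]
  intro h0
  rw [h0, nonpos_iff_eq_zero] at h_le
  simp [degree, h0, h_le] at hr

theorem IsShrub.discard {P : HackenbushPosition V E} (hP : P.IsShrub) : P.discard.IsShrub := by
  obtain ⟨hgreen, r, hground, hr⟩ := hP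
  exact ⟨fun e he => hgreen e (P.edgeSet_discard_subset he), r, hground,
    (P.degree_discard (hground ▸ rfl)).trans hr⟩

theorem isShrub_cut {P : HackenbushPosition V E} (hgreen : ∀ e ∈ P.graph.edgeSet, P.color e = .green)
    {r : V} (hground : P.ground = {r}) (hr : P.degree r = 1) {e : E} (he : ¬ P.graph.Inc e r) :
    (P.cut e).IsShrub :=
  IsShrub.discard ⟨fun _ hf => hgreen _ hf.1, r, hground,
    (P.degree_deleteEdge_of_not_inc he).trans hr⟩

/-- A path from `r` to an end of a surviving edge would have to start with an edge at `r`. -/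
theorem edgeSet_discard_eq_empty {P : HackenbushPosition V E} {r : V} (hground : P.ground = {r})
    (hr : ∀ e, ¬ P.graph.Inc e r) : P.discard.graph.edgeSet = ∅ := by
  refine Set.eq_empty_of_forall_notMem ?_
  rintro e ⟨x, y, h, ⟨s, hs, hsx⟩, -⟩
  obtain rfl : s = r := by rwa [hground] at hs
  rcases Relation.ReflTransGen.cases_head hsx with rfl | ⟨z, ⟨f, hf⟩, -⟩
  · exact hr e ⟨y, h⟩
  · exact hr f ⟨z, hf⟩

theorem edgeSet_cut_eq_empty {P : HackenbushPosition V E} {r : V} (hground : P.ground = {r})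
    {e : E} (he : P.graph.incidenceSet r = {e}) : (P.cut e).graph.edgeSet = ∅ := by
  refine edgeSet_discard_eq_empty hground ?_
  rintro f ⟨x, hf⟩
  have hf' := (Graph.deleteEdges_isLink ..).mp hf
  have : f ∈ P.graph.incidenceSet r := ⟨x, hf'.1⟩
  rw [he] at this
  exact hf'.2 this

theorem isEmpty_moves {P : HackenbushPosition V E} (h : P.graph.edgeSet = ∅) (p : Player) :
    IsEmpty {e : E // e ∈ P.graph.edgeSet ∧ (P.color e).CutBy p} :=
  ⟨fun e => by simpa [h] using e.2.1⟩

/-- The game of a Shrub is misère equivalent to the nim-heap of its normal-play nim-value. -/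
theorem IsShrub.play_misereEquiv {P : HackenbushPosition V E} (hP : P.IsShrub) :
    MisereEquiv P.play (nimHeap (nimValue P.play)) := by
  induction hn : P.graph.edgeSet.ncard using Nat.strong_induction_on generalizing P with
  | _ n ih =>
  obtain ⟨hgreen, r, hground, hr⟩ := hP
  obtain ⟨e₀, he₀⟩ := P.exists_incidenceSet_eq_singleton hr
  have he₀_mem : e₀ ∈ P.graph.edgeSet := by
    obtain ⟨x, hx⟩ : e₀ ∈ P.graph.incidenceSet r := he₀ ▸ rfl
    exact hx.edge_mem
  have hcut (e : E) (he : e ∈ P.graph.edgeSet) (p : Player) : (P.color e).CutBy p := by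
    rw [hgreen e he]
    trivial
  have hempty := isEmpty_moves (edgeSet_cut_eq_empty hground he₀)
  have hequiv (e : E) (he : e ∈ P.graph.edgeSet) :
      MisereEquiv (P.cut e).play (nimHeap (nimValue (P.cut e).play)) := by
    -- Cutting the root edge leaves no Shrub, but the game without moves.
    by_cases heq : e = e₀
    · subst heq
      rw [play, nimValue_eq_zero hempty]
      exact misereEquiv_nimHeap_zero hempty
    · refine ih _ (hn ▸ P.ncard_edgeSet_cut_lt he)
        (isShrub_cut hgreen hground hr fun hinc => heq ?_) rfl
      have : e ∈ P.graph.incidenceSet r := hinc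
      rwa [he₀] at this
  have hfinite (p : Player) : Finite {e : E // e ∈ P.graph.edgeSet ∧ (P.color e).CutBy p} :=
    P.finite_edgeSet.subset fun _ h => h.1
  have hne (p : Player) (e : {e : E // e ∈ P.graph.edgeSet ∧ (P.color e).CutBy p}) :
      nimValue (P.cut e.1).play ≠ nimValue P.play := by
    rw [play.eq_1 P]
    exact nimValue_option_ne (I := fun p => {e : E // e ∈ P.graph.edgeSet ∧ (P.color e).CutBy p})
      (fun _ e => (P.cut e.1).play) p e
  have hlt (k : ℕ) (hk : k < nimValue P.play) :
      ∃ e ∈ P.graph.edgeSet, nimValue (P.cut e).play = k := by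
    rw [play] at hk
    obtain ⟨p, e, he⟩ := exists_nimValue_option_eq _ hk
    exact ⟨e.1, e.2.1, he⟩
  have hpos : nimValue P.play ≠ 0 := by
    have h := hne .left ⟨e₀, he₀_mem, hcut _ he₀_mem _⟩
    rw [play.eq_1 (P.cut e₀), nimValue_eq_zero hempty] at h
    exact h.symm
  generalize nimValue P.play = m at hne hlt hpos ⊢
  rw [play]
  refine misereEquiv_nimHeap (fun p e => ⟨_, hne p e, hequiv e.1 e.2.1⟩)
    (fun p k hk => ?_) (fun h0 => absurd h0 hpos)
  -- The edge attaining `k` is green, so either player may cut it, as the mex rule requires.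
  obtain ⟨e, he, rfl⟩ := hlt k hk
  exact ⟨⟨e, he, hcut e he p⟩, hequiv e he⟩

/-! ### Stalks -/

theorem groundedSet_eq_Iic {P : HackenbushPosition ℕ (ULift.{u} ℕ)} {n : ℕ}
    (hground : P.ground = {0})
    (hlink : ∀ e x y, P.graph.IsLink e x y → (x ≤ n ↔ y ≤ n))
    (hadj : ∀ i < n, P.graph.Adj i (i + 1)) : P.groundedSet = Set.Iic n := by
  ext x
  simp only [groundedSet, hground, Set.mem_singleton_iff, exists_eq_left, Set.mem_ofPred_eq,
    Set.mem_Iic]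
  constructor
  · intro h
    induction h with
    | refl => exact Nat.zero_le n
    | tail _ h ih =>
      obtain ⟨e, he⟩ := h
      exact (hlink e _ _ he).mp ih
  · intro h
    induction x with
    | zero => exact .refl
    | succ x ih => exact (ih (by omega)).tail (hadj x (by omega))

/-- The links are compared only up to height `n`, since everything above is discarded. -/
theorem discard_eq_stalk {P : HackenbushPosition ℕ (ULift.{u} ℕ)} {n : ℕ}
    (hground : P.ground = {0}) (hcolor : P.color = fun _ => .green)
    (hset : P.groundedSet = Set.Iic n)
    (hlink : ∀ e x y, x ≤ n → y ≤ n → (P.graph.IsLink e x y ↔ (stalk n).graph.IsLink e x y)) :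
    P.discard = stalk n := by
  have hgraph : P.discard.graph = (stalk n).graph := by
    refine Graph.ext hset fun e x y => ?_
    change P.graph.IsLink e x y ∧ x ∈ P.groundedSet ∧ y ∈ P.groundedSet ↔ _
    rw [hset]
    constructor
    · rintro ⟨h, hx, hy⟩
      exact (hlink e x y hx hy).mp h
    · intro h
      exact ⟨(hlink e x y h.left_mem h.right_mem).mpr h, h.left_mem, h.right_mem⟩
  have hg : P.discard.ground = (stalk n).ground := hground
  have hc : P.discard.color = (stalk n).color := hcolor
  revert hgraph hg hc
  generalize P.discard = Q
  generalize stalk n = R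
  cases Q
  cases R
  rintro rfl rfl rfl
  rfl

theorem discard_stalk (n : ℕ) : (stalk.{u} n).discard = stalk n :=
  discard_eq_stalk rfl rfl
    (groundedSet_eq_Iic rfl (fun _ _ _ h => iff_of_true h.left_mem h.right_mem)
      fun i hi => ⟨⟨i⟩, hi, .inl ⟨rfl, rfl⟩⟩)
    fun _ _ _ _ _ => Iff.rfl

theorem cut_stalk {n : ℕ} {e : ULift.{u} ℕ} (he : e.down < n) :
    (stalk n).cut e = stalk e.down := by
  have hlink (f : ULift.{u} ℕ) (x y : ℕ) : ((stalk n).deleteEdge e).graph.IsLink f x y ↔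
      (f.down < n ∧ (x = f.down ∧ y = f.down + 1 ∨ y = f.down ∧ x = f.down + 1)) ∧
        f.down ≠ e.down := by
    refine (Graph.deleteEdges_isLink ..).to_iff.trans (and_congr Iff.rfl ?_)
    rw [Set.mem_singleton_iff, ← ULift.down_inj]
  refine discard_eq_stalk rfl rfl (groundedSet_eq_Iic rfl (fun f x y h => ?_) fun i hi => ?_)
    fun f x y hx hy => ?_
  -- Only the deleted edge joined a height at most `e.down` to a greater one.
  · rw [hlink] at h
    omega
  · exact ⟨⟨i⟩, (hlink ..).mpr ⟨⟨hi.trans he, .inl ⟨rfl, rfl⟩⟩, hi.ne⟩⟩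
  · rw [hlink]
    change _ ↔ f.down < e.down ∧ (x = f.down ∧ y = f.down + 1 ∨ y = f.down ∧ x = f.down + 1)
    omega

theorem mem_edgeSet_stalk {n : ℕ} {e : ULift.{u} ℕ} :
    e ∈ (stalk n).graph.edgeSet ↔ e.down < n :=
  ⟨fun ⟨_, _, h⟩ => h.1, fun h => ⟨_, _, h, .inl ⟨rfl, rfl⟩⟩⟩

/-- The Stalk of height `n` is misère equivalent to the nim-heap `*ₙ`. -/
theorem play_stalk_misereEquiv (n : ℕ) : MisereEquiv (stalk.{u} n).play (nimHeap n) := by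
  induction n using Nat.strong_induction_on with
  | _ n ih =>
  have hequiv (e : ULift.{u} ℕ) (he : e.down < n) :
      MisereEquiv ((stalk n).cut e).play (nimHeap e.down) := by
    rw [cut_stalk he]
    exact ih _ he
  rw [play]
  refine misereEquiv_nimHeap (fun p e => ?_) (fun p k hk => ?_) (fun h0 p => ⟨fun e => ?_⟩)
  · have he := mem_edgeSet_stalk.mp e.2.1
    exact ⟨_, he.ne, hequiv e.1 he⟩
  · exact ⟨⟨⟨k⟩, mem_edgeSet_stalk.mpr hk, trivial⟩, hequiv ⟨k⟩ hk⟩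
  · have he := mem_edgeSet_stalk.mp e.2.1
    omega

end HackenbushPosition

theorem theorem1p1 {V : Type v} {E : Type u} (S : HackenbushPosition V E) (hS : S.IsShrub)
    (T : CombGame.{u}) :
    CombGame.outcome .misere (S.toGame + T) =
        CombGame.outcome .misere (CombGame.nimHeap (CombGame.nimValue S.toGame) + T) ∧
      CombGame.outcome .misere (S.toGame + T) =
        CombGame.outcome .misere
          ((HackenbushPosition.stalk (CombGame.nimValue S.toGame)).toGame + T) := by
  have h : CombGame.MisereEquiv S.toGame (CombGame.nimHeap (CombGame.nimValue S.toGame)) :=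
    hS.discard.play_misereEquiv
  refine ⟨h.outcome_add_eq T, (h.trans ?_).outcome_add_eq T⟩
  rw [HackenbushPosition.toGame.eq_1 (HackenbushPosition.stalk _),
    HackenbushPosition.discard_stalk]
  exact (HackenbushPosition.play_stalk_misereEquiv _).symm
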